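/- Notation. Let $(a)_n=\prod_{i=1}^{n}(a+i-1)$, let ${}_2F_1(a,b;c;z)$ be the Gauss hypergeometric function (the polynomial given by its series when the series terminates, otherwise the analytic continuation of the series to $\mathbf C\setminus[1,\infty)$), and take principal branches of all powers and square roots. The Gegenbauer polynomials are $$C_n^\mu(z)=\frac{(2\mu)_n}{n!}\,{}_2F_1\Bigl(-n,n+2\mu;\mu+\tfrac12;\tfrac{1-z}{2}\Bigr).$$ The associated Legendre function of the first kind is, for $z\in\mathbf C\setminus(-\infty,1]$, $$P_\nu^\mu(z)=\frac{1}{\Gamma(1-\mu)}\Bigl(\frac{z+1}{z-1}\Bigr)^{\mu/2}{}_2F_1\Bigl(-\nu,\nu+1;1-\mu;\tfrac{1-z}{2}\Bigr),$$ and the Ferrers function of the first kind is, for $t\in(-1,1)$, $$\mathrm P_\nu^\mu(t)=\frac{1}{\Gamma(1-\mu)}\Bigl(\frac{1+t}{1-t}\Bigr)^{\mu/2}{}_2F_1\Bigl(-\nu,\nu+1;1-\mu;\tfrac{1-t}{2}\Bigr).$$ Write $\mathbf D=\{z\in\mathbf C:|z|<1\}$, $\mathrm R=\sqrt{1+\rho^2-2\rho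 x}$ and $\zeta_\pm=(1\pm\rho)/\mathrm R$. Statement. Let $m\in\{0,1,2,\dots\}$, $\mu\in(-\tfrac12,\infty)\setminus\{0\}$ and $x\in[-1,1]$. (i) If $\rho\in\mathbf D\setminus(-1,0]$, then $$\frac{1}{\mathrm R^{2\mu+m}}C_m^\mu(\zeta_+)=\frac{2\Gamma(2\mu+m)}{m!\,\rho^\mu(1-\rho)^m}\sum_{n=0}^\infty (n+\mu)(2\mu+m)_{2n}\,P_{-m}^{-2\mu-2n}\Bigl(\frac{1+\rho}{1-\rho}\Bigr)C_n^\mu(x).$$ (ii) If $\rho\in(0,1)$, then $$\frac{1}{\mathrm R^{2\mu+m}}C_m^\mu(\zeta_-)=\frac{2\Gamma(2\mu+m)}{m!\,\rho^\mu(1+\rho)^m}\sum_{n=0}^\infty (n+\mu)(2\mu+m)_{2n}\,\mathrm P_{-m}^{-2\mu-2n}\Bigl(\frac{1-\rho}{1+\rho}\Bigr)C_n^\mu(x).$$ In both cases the series converges absolutely. -/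

import Mathlib

/-- The Pochhammer symbol `(a)_n = a (a + 1) ⋯ (a + n - 1)`. -/
noncomputable def poch (a : ℂ) (n : ℕ) : ℂ := ∏ i ∈ Finset.range n, (a + (i : ℂ))

/-- The hypergeometric series in `z` with upper parameters `a`, `b` terminates (is a polynomial). -/
def HypTerminates (a b : ℂ) : Prop := ∃ k : ℕ, a = -(k : ℂ) ∨ b = -(k : ℂ)

/-- `F` is the analytic continuation of the Gauss hypergeometric series from the unit disk to the
plane cut along `[1, ∞)`. -/
def IsHypContinuation (a b c : ℂ) (F : ℂ → ℂ) : Prop :=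
  AnalyticOnNhd ℂ F {z | 1 - z ∈ Complex.slitPlane} ∧
    ∀ z : ℂ, ‖z‖ < 1 → F z = ordinaryHypergeometric a b c z

open Classical in
/-- The Gauss hypergeometric function `₂F₁(a, b; c; z)`, for `c` not a non-positive integer.
If the series terminates it is that polynomial, for every `z`; otherwise it is, on the plane cut
along `[1, ∞)`, the analytic continuation of the series (which is unique by the identity theorem),
and the series itself on the cut (of interest at `z = 1` only). -/
noncomputable def gaussF (a b c z : ℂ) : ℂ :=
  if HypTerminates a b then ordinaryHypergeometric a b c z
  else if h : 1 - z ∈ Complex.slitPlane ∧ ∃ F : ℂ → ℂ, IsHypContinuation a b c F then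
    h.2.choose z
  else ordinaryHypergeometric a b c z

/-- The Gegenbauer polynomial `C_n^μ(z)`. -/
noncomputable def gegenbauerC (n : ℕ) (μ : ℝ) (z : ℂ) : ℂ :=
  poch (2 * μ) n / (n.factorial : ℂ) *
    gaussF (-(n : ℂ)) ((n : ℂ) + 2 * μ) (μ + 1 / 2) ((1 - z) / 2)

/-- The associated Legendre function of the first kind `P_ν^μ(z)` of degree `ν` and order `μ`
(`μ` not a positive integer), for `z ∈ ℂ ∖ (-∞, 1]`, with principal branches. -/
noncomputable def legendreP (ν μ z : ℂ) : ℂ :=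
  1 / Complex.Gamma (1 - μ) * ((z + 1) / (z - 1)) ^ (μ / 2) *
    gaussF (-ν) (ν + 1) (1 - μ) ((1 - z) / 2)

/-- The Ferrers function of the first kind of degree `ν` and order `μ`
(`μ` not a positive integer), for `x ∈ (-1, 1)`. -/
noncomputable def ferrersP (ν μ : ℂ) (x : ℝ) : ℂ :=
  1 / Complex.Gamma (1 - μ) * ((1 + (x : ℂ)) / (1 - (x : ℂ))) ^ (μ / 2) *
    gaussF (-ν) (ν + 1) (1 - μ) ((1 - (x : ℂ)) / 2)

/-- `R(ρ, x) = √(1 + ρ² - 2ρx)`, principal square root. -/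
noncomputable def bigR (ρ : ℂ) (x : ℝ) : ℂ := (1 + ρ ^ 2 - 2 * ρ * (x : ℂ)) ^ (1 / 2 : ℂ)

/-- `ζ₊(ρ, x) = (1 + ρ) / R(ρ, x)`. -/
noncomputable def zetaPlus (ρ : ℂ) (x : ℝ) : ℂ := (1 + ρ) / bigR ρ x

/-- `ζ₋(ρ, x) = (1 - ρ) / R(ρ, x)`. -/
noncomputable def zetaMinus (ρ : ℂ) (x : ℝ) : ℂ := (1 - ρ) / bigR ρ x

/-- The domain `𝐃 ∖ (-1, 0]`: the open unit disk without its non-positive real points. -/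
def slitDisk : Set ℂ := {ρ | ‖ρ‖ < 1} \ {ρ | ∃ t : ℝ, t ∈ Set.Ioc (-1 : ℝ) 0 ∧ ρ = (t : ℂ)}

/-- The `n`-th term of the expansion with `ζ₊`. -/
noncomputable def plusTerm (m : ℕ) (μ x : ℝ) (ρ : ℂ) (n : ℕ) : ℂ :=
  ((n : ℂ) + μ) * poch (2 * μ + m) (2 * n) *
    legendreP (-(m : ℂ)) (-2 * μ - 2 * n) ((1 + ρ) / (1 - ρ)) * gegenbauerC n μ x

/-- The `n`-th term of the expansion with `ζ₋`. -/
noncomputable def minusTerm (m : ℕ) (μ x ρ : ℝ) (n : ℕ) : ℂ :=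
  ((n : ℂ) + μ) * poch (2 * μ + m) (2 * n) *
    ferrersP (-(m : ℂ)) (-2 * μ - 2 * n) ((1 - ρ) / (1 + ρ)) * gegenbauerC n μ x

/-! After the prefactor is absorbed, Gamma factors and `ρ ^ μ` cancel, and (i) becomes `A_m(ρ) = ∑
C_n^μ(x) T_{n,m}(ρ)`. Here `T_{n,m}` (`kernelCoeff`) is `ρ ^ n` times a rational function
holomorphic on the whole unit disk, since every hypergeometric series involved terminates.

This is proved by induction on `m`. The case `m = 0` is the Gegenbauer generating function. Both
`A_m` and each `T_{n,m}` satisfy `(m+1)(1-ρ) A_{m+1} = (2μ+m) A_m + 2ρ A_m'`: for `A_m` by the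
degree-raising relation of Gegenbauer polynomials (`gegenbauerKernel_succ`), for `T_{n,m}` by a
contiguous relation of the hypergeometric polynomial (`kernelCoeff_succ`). The operator does not
depend on `n`, so it may be applied termwise; normal convergence on smaller disks justifies this
(`SumsNormally.deriv`).

The reduced identity holds on the negative axis too, so (ii) is the same identity at `(-ρ, -x)`,
combined with the parity of `C_n^μ`. -/

theorem poch_zero (a : ℂ) : poch a 0 = 1 := by simp [poch]

theorem poch_succ (a : ℂ) (n : ℕ) : poch a (n + 1) = poch a n * (a + n) :=
  Finset.prod_range_succ _ _

theorem poch_succ_left (a : ℂ) (n : ℕ) : poch a (n + 1) = a * poch (a + 1) n := by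
  rw [poch, Finset.prod_range_succ', mul_comm]
  simp only [poch, Nat.cast_zero, add_zero, Nat.cast_add, Nat.cast_one]
  congr 1
  exact Finset.prod_congr rfl fun i _ => by ring

theorem poch_add (a : ℂ) (m n : ℕ) : poch a (m + n) = poch a m * poch (a + m) n := by
  rw [poch, Finset.prod_range_add]
  simp only [poch, Nat.cast_add, add_assoc]

theorem poch_neg_eq_zero {j n : ℕ} (h : j < n) : poch (-(j : ℂ)) n = 0 :=
  Finset.prod_eq_zero (Finset.mem_range.2 h) (by simp)

theorem poch_ne_zero {a : ℂ} (ha : 0 < a.re) (n : ℕ) : poch a n ≠ 0 := by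
  refine Finset.prod_ne_zero_iff.2 fun i _ h => ?_
  have := congrArg Complex.re h
  simp at this
  have : (0 : ℝ) ≤ i := Nat.cast_nonneg i
  linarith

theorem ascPochhammer_eval_eq_poch (a : ℂ) (n : ℕ) : (ascPochhammer ℂ n).eval a = poch a n := by
  induction n with
  | zero => simp [poch]
  | succ n ih => rw [ascPochhammer_succ_eval, ih, poch_succ]

/-! ### Terminating hypergeometric series as polynomials -/

/-- The coefficients of the Gauss hypergeometric series. -/
noncomputable def hypCoeff (a b c : ℂ) (k : ℕ) : ℂ :=
  poch a k * poch b k / (poch c k * k.factorial)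

/-- The Gauss hypergeometric series truncated after degree `N`. -/
noncomputable def hypPoly (a b c : ℂ) (N : ℕ) : Polynomial ℂ :=
  ∑ k ∈ Finset.range (N + 1), Polynomial.monomial k (hypCoeff a b c k)

theorem hypCoeff_eq_zero {a b : ℂ} {j k : ℕ} (c : ℂ) (hj : j < k)
    (h : a = -(j : ℂ) ∨ b = -(j : ℂ)) : hypCoeff a b c k = 0 := by
  rcases h with rfl | rfl <;> simp [hypCoeff, poch_neg_eq_zero hj]

/-- The truncation degree `N` need only bound the true degree, so polynomials of different degrees
can share one `N` and be compared coefficientwise. -/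
theorem hypPoly_coeff {a b : ℂ} {j N : ℕ} (c : ℂ) (hj : j ≤ N)
    (h : a = -(j : ℂ) ∨ b = -(j : ℂ)) (k : ℕ) : (hypPoly a b c N).coeff k = hypCoeff a b c k := by
  simp only [hypPoly, Polynomial.finsetSum_coeff, Polynomial.coeff_monomial, Finset.sum_ite_eq',
    Finset.mem_range]
  split_ifs with hk
  · rfl
  · exact (hypCoeff_eq_zero c (by omega) h).symm

theorem gaussF_eq_hypPoly {a b : ℂ} {j N : ℕ} (c : ℂ) (hj : j ≤ N)
    (h : a = -(j : ℂ) ∨ b = -(j : ℂ)) (z : ℂ) : gaussF a b c z = (hypPoly a b c N).eval z := by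
  have e : ∀ k : ℕ, ((k.factorial : ℂ)⁻¹ * (ascPochhammer ℂ k).eval a *
      (ascPochhammer ℂ k).eval b * ((ascPochhammer ℂ k).eval c)⁻¹) • z ^ k =
      hypCoeff a b c k * z ^ k := fun k => by
    simp only [ascPochhammer_eval_eq_poch, hypCoeff, smul_eq_mul, div_eq_mul_inv, mul_inv]
    ring
  rw [gaussF, if_pos ⟨j, h⟩, ordinaryHypergeometric_eq_tsum]
  simp only [e]
  rw [tsum_eq_sum (s := Finset.range (N + 1)), hypPoly, Polynomial.eval_finsetSum]
  · simp
  · intro k hk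
    rw [hypCoeff_eq_zero c (by simp at hk; omega) h, zero_mul]

/-! ### A contiguous relation for the Legendre-type polynomial -/

section Legendre

open Polynomial

/-- The `w ^ (k + 1)` coefficient of the relation in `gaussF_legendre_succ`. Positivity is asked of
`c + 1` because `c = 2μ + 2n` may be negative when `n = 0`. -/
theorem hypCoeff_legendre_succ {c : ℂ} (hc : 0 < (c + 1).re) (m : ℂ) (k : ℕ) :
    (c + m) * hypCoeff (m + 1) (-m) (c + 1) (k + 1) =
      (c + m + 2 * (k + 1)) * hypCoeff m (1 - m) (c + 1) (k + 1) -
        2 * (m + k) * hypCoeff m (1 - m) (c + 1) k := by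
  have h1 : poch m k * (m + k) = m * poch (m + 1) k := by rw [← poch_succ, poch_succ_left]
  have hk : poch (c + 1) k ≠ 0 := poch_ne_zero hc k
  have hk1 : c + 1 + k ≠ 0 := fun h => poch_ne_zero hc (k + 1) (by rw [poch_succ, h, mul_zero])
  have hf : (k.factorial : ℂ) ≠ 0 := by exact_mod_cast k.factorial_ne_zero
  have hk2 : (k : ℂ) + 1 ≠ 0 := by exact_mod_cast k.succ_ne_zero
  have e : 2 * (m + k) * hypCoeff m (1 - m) (c + 1) k =
      2 * (m * poch (m + 1) k) * poch (1 - m) k / (poch (c + 1) k * k.factorial) := by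
    rw [← h1, hypCoeff]; ring
  rw [e, hypCoeff, hypCoeff, poch_succ (m + 1), poch_succ_left (-m), poch_succ_left m,
    poch_succ (1 - m), poch_succ (c + 1), Nat.factorial_succ, show -m + 1 = 1 - m by ring]
  push_cast
  field_simp
  ring

theorem gaussF_legendre_succ {c : ℂ} (hc : 0 < (c + 1).re) (m : ℕ) (w : ℂ) :
    ∃ F' : ℂ, HasDerivAt (gaussF m (1 - m) (c + 1)) F' w ∧
      (c + m) * gaussF (m + 1) (-m) (c + 1) w =
        (c + m - 2 * m * w) * gaussF m (1 - m) (c + 1) w + 2 * w * (1 - w) * F' := by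
  -- The series stops because of the upper parameter `0` when `m = 0`, and because of `1 - m` when
  -- `m ≥ 1`.
  obtain ⟨j, hj, h⟩ : ∃ j ≤ m, (m : ℂ) = -(j : ℂ) ∨ (1 - m : ℂ) = -(j : ℂ) := by
    rcases m with _ | m
    · exact ⟨0, le_rfl, by simp⟩
    · exact ⟨m, m.le_succ, Or.inr (by push_cast; ring)⟩
  have e1 : gaussF m (1 - m) (c + 1) = fun z => (hypPoly m (1 - m) (c + 1) m).eval z :=
    funext fun z => gaussF_eq_hypPoly _ hj h z
  have h' : (m + 1 : ℂ) = -(m : ℂ) ∨ (-m : ℂ) = -(m : ℂ) := Or.inr rfl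
  rw [e1, gaussF_eq_hypPoly (c + 1) le_rfl h']
  refine ⟨_, Polynomial.hasDerivAt _ _, ?_⟩
  have key : C (c + m) * hypPoly (m + 1) (-m) (c + 1) m =
      C (c + m) * hypPoly m (1 - m) (c + 1) m - X * (C (2 * m : ℂ) * hypPoly m (1 - m) (c + 1) m) +
       (X * (C 2 * derivative (hypPoly m (1 - m) (c + 1) m)) -
        X * (X * (C 2 * derivative (hypPoly m (1 - m) (c + 1) m)))) := by
    ext k
    rcases k with _ | _ | k
    · simp [hypPoly_coeff _ le_rfl h', hypPoly_coeff _ hj h, hypCoeff, poch_zero]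
    all_goals
      simp only [coeff_add, coeff_sub, coeff_C_mul, coeff_X_mul, coeff_derivative,
        hypPoly_coeff _ le_rfl h', hypPoly_coeff _ hj h, hypCoeff_legendre_succ hc,
        mul_coeff_zero, coeff_X_zero, coeff_C_zero]
      push_cast
      ring
  have := congrArg (eval w) key
  simp only [eval_add, eval_sub, eval_mul, eval_C, eval_X] at this
  rw [this]
  ring

end Legendre

/-! ### Recurrences and parity of Gegenbauer polynomials -/

section Gegenbauer

open Polynomial

/-- The coefficient of `((1 - z) / 2) ^ k` in the Gegenbauer polynomial. -/
noncomputable def gegenbauerCoeff (n : ℕ) (μ : ℂ) (k : ℕ) : ℂ :=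
  poch (2 * μ) (n + k) * poch (-n) k / (n.factorial * (poch (μ + 1 / 2) k * k.factorial))

/-- The Gegenbauer polynomial in the variable `(1 - z) / 2`. -/
noncomputable def gegenbauerPoly (n : ℕ) (μ : ℂ) : ℂ[X] :=
  C (poch (2 * μ) n / n.factorial) * hypPoly (-n) (n + 2 * μ) (μ + 1 / 2) n

theorem gegenbauerPoly_coeff (n : ℕ) (μ : ℂ) (k : ℕ) :
    (gegenbauerPoly n μ).coeff k = gegenbauerCoeff n μ k := by
  rw [gegenbauerPoly, coeff_C_mul, hypPoly_coeff _ le_rfl (Or.inl rfl), hypCoeff,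
    gegenbauerCoeff, poch_add, add_comm (n : ℂ), div_mul_div_comm]
  ring

theorem gegenbauerC_eq_eval (n : ℕ) (μ : ℝ) (z : ℂ) :
    gegenbauerC n μ z = (gegenbauerPoly n μ).eval ((1 - z) / 2) := by
  rw [gegenbauerC, gaussF_eq_hypPoly _ le_rfl (Or.inl rfl), gegenbauerPoly, eval_mul, eval_C]

/-- Coefficient form of `gegenbauerC_succ` in `w = (1 - z) / 2`, where `(z² - 1) d/dz` becomes `2w(1
- w) d/dw`. -/
theorem gegenbauerCoeff_succ_succ {μ : ℂ} (hμ : 0 < (μ + 1 / 2).re) (n k : ℕ) :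
    (n + 1) * gegenbauerCoeff (n + 1) μ (k + 1) =
      (2 * μ + n + 2 * (k + 1)) * gegenbauerCoeff n μ (k + 1) -
        2 * (2 * μ + n + k) * gegenbauerCoeff n μ k := by
  have hk : poch (μ + 1 / 2) k ≠ 0 := poch_ne_zero hμ k
  have hk1 : μ + 1 / 2 + k ≠ 0 := fun h => poch_ne_zero hμ (k + 1) (by rw [poch_succ, h, mul_zero])
  have hf : (k.factorial : ℂ) ≠ 0 := by exact_mod_cast k.factorial_ne_zero
  have hn : (n.factorial : ℂ) ≠ 0 := by exact_mod_cast n.factorial_ne_zero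
  have hk2 : (k : ℂ) + 1 ≠ 0 := by exact_mod_cast k.succ_ne_zero
  have hn2 : (n : ℂ) + 1 ≠ 0 := by exact_mod_cast n.succ_ne_zero
  simp only [gegenbauerCoeff]
  rw [show n + 1 + (k + 1) = n + k + 1 + 1 by ring, show n + (k + 1) = n + k + 1 by ring]
  simp only [poch_succ (2 * μ), poch_succ (μ + 1 / 2), Nat.factorial_succ]
  rw [poch_succ_left (-((n + 1 : ℕ) : ℂ)), poch_succ (-(n : ℂ))]
  push_cast
  rw [show -((n : ℂ) + 1) + 1 = -n by ring]
  generalize poch (2 * μ) (n + k) = p at *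
  generalize poch (-(n : ℂ)) k = q at *
  generalize poch (μ + 1 / 2) k = r at *
  rw [show μ + 1 / 2 + (k : ℂ) = (2 * μ + 1 + 2 * k) / 2 by ring] at *
  have hk3 : 2 * μ + 1 + 2 * (k : ℂ) ≠ 0 := fun h => hk1 (by rw [h, zero_div])
  field_simp
  ring

theorem gegenbauerCoeff_three_term {μ : ℂ} (hμ : 0 < (μ + 1 / 2).re) (n k : ℕ) :
    (n + 2) * gegenbauerCoeff (n + 2) μ (k + 1) =
      2 * (n + 1 + μ) * (gegenbauerCoeff (n + 1) μ (k + 1) - 2 * gegenbauerCoeff (n + 1) μ k) -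
        (n + 2 * μ) * gegenbauerCoeff n μ (k + 1) := by
  have hk : poch (μ + 1 / 2) k ≠ 0 := poch_ne_zero hμ k
  have hk1 : μ + 1 / 2 + k ≠ 0 := fun h => poch_ne_zero hμ (k + 1) (by rw [poch_succ, h, mul_zero])
  have hf : (k.factorial : ℂ) ≠ 0 := by exact_mod_cast k.factorial_ne_zero
  have hn : (n.factorial : ℂ) ≠ 0 := by exact_mod_cast n.factorial_ne_zero
  have hk2 : (k : ℂ) + 1 ≠ 0 := by exact_mod_cast k.succ_ne_zero
  have hn2 : (n : ℂ) + 1 ≠ 0 := by exact_mod_cast n.succ_ne_zero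
  have hn3 : (n : ℂ) + 2 ≠ 0 := by exact_mod_cast (n + 1).succ_ne_zero
  have hn4 : (n : ℂ) + 1 + 1 ≠ 0 := by exact_mod_cast (n + 1).succ_ne_zero
  -- The degrees `n`, `n + 1`, `n + 2` bring three different Pochhammer symbols; all are expressed
  -- through the middle one, `(-(n + 1))_k`.
  have h0 : poch (-(n : ℂ)) (k + 1) =
      -(poch (-((n : ℂ) + 1)) k * (k - n - 1) * (k - n)) / (n + 1) := by
    have := poch_succ_left (-((n : ℂ) + 1)) (k + 1)
    rw [poch_succ, poch_succ, show -((n : ℂ) + 1) + 1 = -n by ring] at this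
    push_cast at this
    rw [eq_div_iff hn2]
    linear_combination this
  simp only [gegenbauerCoeff]
  rw [show n + 2 + (k + 1) = n + k + 1 + 1 + 1 by ring, show n + 1 + (k + 1) = n + k + 1 + 1 by ring,
    show n + 1 + k = n + k + 1 by ring, show n + (k + 1) = n + k + 1 by ring, h0]
  simp only [poch_succ (2 * μ), poch_succ (μ + 1 / 2), Nat.factorial_succ]
  rw [poch_succ_left (-((n + 2 : ℕ) : ℂ)), poch_succ (-((n + 1 : ℕ) : ℂ))]
  push_cast
  rw [show -((n : ℂ) + 2) + 1 = -(n + 1) by ring]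
  generalize poch (2 * μ) (n + k) = p at *
  generalize poch (-((n : ℂ) + 1)) k = q at *
  generalize poch (μ + 1 / 2) k = r at *
  rw [show μ + 1 / 2 + (k : ℂ) = (2 * μ + 1 + 2 * k) / 2 by ring] at *
  have hk3 : 2 * μ + 1 + 2 * (k : ℂ) ≠ 0 := fun h => hk1 (by rw [h, zero_div])
  field_simp
  ring

theorem gegenbauerC_zero (μ : ℝ) (z : ℂ) : gegenbauerC 0 μ z = 1 := by
  rw [gegenbauerC_eq_eval, gegenbauerPoly, hypPoly]
  simp [hypCoeff, poch_zero]

theorem re_add_half_pos {μ : ℝ} (hμ : -1 / 2 < μ) : 0 < ((μ : ℂ) + 1 / 2).re := by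
  have : ((μ : ℂ) + 1 / 2).re = μ + 1 / 2 := by simp
  rw [this]
  linarith

theorem gegenbauerC_one {μ : ℝ} (hμ : -1 / 2 < μ) (z : ℂ) :
    gegenbauerC 1 μ z = 2 * μ * z := by
  have h : (μ : ℂ) + 1 / 2 ≠ 0 := fun h => by
    have := re_add_half_pos hμ
    rw [h] at this
    simp at this
  have h' : 1 + 2 * (μ : ℂ) ≠ 0 := fun e => h (by linear_combination e / 2)
  rw [gegenbauerC_eq_eval, gegenbauerPoly, hypPoly]
  simp only [hypCoeff, poch_zero, Finset.sum_range_succ, poch_succ, eval_mul, eval_C, eval_add,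
    eval_monomial, Finset.range_zero, Finset.sum_empty, Nat.factorial, Nat.cast_one, zero_add, Nat.cast_zero, add_zero]
  rw [show (μ : ℂ) + 1 / 2 = (1 + 2 * μ) / 2 by ring]
  push_cast
  field_simp
  ring

theorem gegenbauerC_three_term {μ : ℝ} (hμ : -1 / 2 < μ) (n : ℕ) (z : ℂ) :
    (n + 2) * gegenbauerC (n + 2) μ z =
      2 * (n + 1 + μ) * z * gegenbauerC (n + 1) μ z - (n + 2 * μ) * gegenbauerC n μ z := by
  have key : C (n + 2 : ℂ) * gegenbauerPoly (n + 2) μ =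
      C (2 * (n + 1 + μ) : ℂ) * gegenbauerPoly (n + 1) μ -
        X * (C (4 * (n + 1 + μ) : ℂ) * gegenbauerPoly (n + 1) μ) -
        C (n + 2 * μ : ℂ) * gegenbauerPoly n μ := by
    ext k
    rcases k with _ | k
    · have hn : (n.factorial : ℂ) ≠ 0 := by exact_mod_cast n.factorial_ne_zero
      have hn2 : (n : ℂ) + 1 ≠ 0 := by exact_mod_cast n.succ_ne_zero
      have hn3 : (n : ℂ) + 2 ≠ 0 := by exact_mod_cast (n + 1).succ_ne_zero
      have hn4 : (n : ℂ) + 1 + 1 ≠ 0 := by exact_mod_cast (n + 1).succ_ne_zero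
      simp only [coeff_sub, coeff_C_mul, coeff_X_mul_zero, gegenbauerPoly_coeff, gegenbauerCoeff,
        poch_zero, add_zero, Nat.factorial_succ, poch_succ]
      push_cast
      field_simp
      ring
    · simp only [coeff_sub, coeff_C_mul, coeff_X_mul, gegenbauerPoly_coeff,
        gegenbauerCoeff_three_term (re_add_half_pos hμ)]
      ring
  have := congrArg (eval ((1 - z) / 2)) key
  simp only [eval_sub, eval_mul, eval_C, eval_X, ← gegenbauerC_eq_eval] at this
  rw [this]
  ring

theorem gegenbauerC_succ {μ : ℝ} (hμ : -1 / 2 < μ) (n : ℕ) (z : ℂ) :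
    ∃ C' : ℂ, HasDerivAt (gegenbauerC n μ) C' z ∧
      (n + 1) * gegenbauerC (n + 1) μ z =
        (2 * μ + n) * z * gegenbauerC n μ z + (z ^ 2 - 1) * C' := by
  have hd : HasDerivAt (gegenbauerC n μ)
      ((derivative (gegenbauerPoly n μ)).eval ((1 - z) / 2) * (-1 / 2)) z := by
    rw [show gegenbauerC n μ = fun z => (gegenbauerPoly n μ).eval ((1 - z) / 2) from
      funext fun z => gegenbauerC_eq_eval n μ z]
    exact (Polynomial.hasDerivAt _ _).comp z (((hasDerivAt_id z).const_sub 1).div_const 2)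
  refine ⟨_, hd, ?_⟩
  have key : C (n + 1 : ℂ) * gegenbauerPoly (n + 1) μ =
      C (2 * μ + n : ℂ) * gegenbauerPoly n μ -
        X * (C (2 * (2 * μ + n) : ℂ) * gegenbauerPoly n μ) +
        (X * (C 2 * derivative (gegenbauerPoly n μ)) -
        X * (X * (C 2 * derivative (gegenbauerPoly n μ)))) := by
    ext k
    rcases k with _ | _ | k
    · have hn : (n.factorial : ℂ) ≠ 0 := by exact_mod_cast n.factorial_ne_zero
      have hn2 : (n : ℂ) + 1 ≠ 0 := by exact_mod_cast n.succ_ne_zero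
      simp only [coeff_add, coeff_sub, coeff_C_mul, coeff_X_mul_zero, gegenbauerPoly_coeff,
        gegenbauerCoeff, poch_zero, add_zero, Nat.factorial_succ, poch_succ]
      push_cast
      field_simp
      ring
    all_goals
      simp only [coeff_add, coeff_sub, coeff_C_mul, coeff_X_mul, coeff_derivative,
        gegenbauerPoly_coeff, gegenbauerCoeff_succ_succ (re_add_half_pos hμ),
        mul_coeff_zero, coeff_X_zero, coeff_C_zero]
      push_cast
      ring
  have := congrArg (eval ((1 - z) / 2)) key
  simp only [eval_add, eval_sub, eval_mul, eval_C, eval_X, ← gegenbauerC_eq_eval] at this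
  rw [this]
  ring

theorem gegenbauerC_neg {μ : ℝ} (hμ : -1 / 2 < μ) (n : ℕ) (z : ℂ) :
    gegenbauerC n μ (-z) = (-1) ^ n * gegenbauerC n μ z := by
  induction n using Nat.twoStepInduction with
  | zero => simp [gegenbauerC_zero]
  | one => simp [gegenbauerC_one hμ]
  | more n h1 h2 =>
    have hn : (n : ℂ) + 2 ≠ 0 := by exact_mod_cast (n + 1).succ_ne_zero
    apply mul_left_cancel₀ hn
    rw [gegenbauerC_three_term hμ, mul_left_comm, gegenbauerC_three_term hμ, h1, h2]
    ring

end Gegenbauer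

/-! ### Normal convergence on the unit disk -/

open Metric

/-- The series of holomorphic functions `T n` converges to `A` on the open unit disk, normally on
every smaller disk. -/
def SumsNormally (T : ℕ → ℂ → ℂ) (A : ℂ → ℂ) : Prop :=
  (∀ n, DifferentiableOn ℂ (T n) (ball 0 1)) ∧
  (∀ r < 1, ∃ u : ℕ → ℝ, Summable u ∧ ∀ n, ∀ z ∈ ball (0 : ℂ) r, ‖T n z‖ ≤ u n) ∧
  ∀ z ∈ ball (0 : ℂ) 1, HasSum (fun n => T n z) (A z)

namespace SumsNormally

variable {T S : ℕ → ℂ → ℂ} {A B : ℂ → ℂ}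

theorem add (hT : SumsNormally T A) (hS : SumsNormally S B) :
    SumsNormally (fun n z => T n z + S n z) (fun z => A z + B z) := by
  refine ⟨fun n => (hT.1 n).add (hS.1 n), fun r hr => ?_, fun z hz => (hT.2.2 z hz).add (hS.2.2 z hz)⟩
  obtain ⟨u, hu, hu'⟩ := hT.2.1 r hr
  obtain ⟨v, hv, hv'⟩ := hS.2.1 r hr
  exact ⟨_, hu.add hv, fun n z hz => norm_add_le_of_le (hu' n z hz) (hv' n z hz)⟩

theorem mul_left {g : ℂ → ℂ} (hg : DifferentiableOn ℂ g (ball 0 1)) (hT : SumsNormally T A) :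
    SumsNormally (fun n z => g z * T n z) (fun z => g z * A z) := by
  refine ⟨fun n => hg.mul (hT.1 n), fun r hr => ?_, fun z hz => (hT.2.2 z hz).mul_left _⟩
  obtain ⟨u, hu, hu'⟩ := hT.2.1 r hr
  obtain ⟨M, hM⟩ := (isCompact_closedBall (0 : ℂ) r).exists_bound_of_continuousOn
    (hg.continuousOn.mono (closedBall_subset_ball hr))
  refine ⟨_, hu.mul_left M, fun n z hz => ?_⟩
  rw [norm_mul]
  have := hM z (ball_subset_closedBall hz)
  exact mul_le_mul this (hu' n z hz) (norm_nonneg _) ((norm_nonneg _).trans this)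

/-- Cauchy's estimate on circles of radius `(s - r) / 2`, for `r < s < 1`, turns a majorant on the
disk of radius `s` into one for the derivatives on the disk of radius `r`. -/
theorem deriv (hT : SumsNormally T A) :
    SumsNormally (fun n => deriv (T n)) (deriv A) := by
  refine ⟨fun n => (hT.1 n).deriv isOpen_ball, fun r hr => ?_, fun z hz => ?_⟩
  · obtain ⟨s, hrs, hs⟩ := exists_between hr
    obtain ⟨u, hu, hu'⟩ := hT.2.1 s hs
    refine ⟨_, hu.div_const ((s - r) / 2), fun n z hz => ?_⟩
    have hd : 0 < (s - r) / 2 := by linarith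
    have hsub : closedBall z ((s - r) / 2) ⊆ ball 0 s := by
      refine closedBall_subset_ball' ?_
      rw [mem_ball] at hz
      linarith
    refine Complex.norm_deriv_le_of_forall_mem_sphere_norm_le hd ?_
      fun w hw => hu' n w (hsub (sphere_subset_closedBall hw))
    exact (hT.1 n).diffContOnCl_ball (hsub.trans (ball_subset_ball hs.le))
  · rw [mem_ball, dist_zero_right] at hz
    obtain ⟨s, hzs, hs⟩ := exists_between hz
    obtain ⟨u, hu, hu'⟩ := hT.2.1 s hs
    have hzs' : z ∈ ball (0 : ℂ) s := by simpa using hzs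
    have := Complex.hasSum_deriv_of_summable_norm hu
      (fun n => (hT.1 n).mono (ball_subset_ball hs.le)) isOpen_ball hu' hzs'
    have e : A =ᶠ[nhds z] fun w => ∑' n, T n w := by
      filter_upwards [isOpen_ball.mem_nhds hzs'] with w hw
      exact (hT.2.2 w (ball_subset_ball hs.le hw)).tsum_eq.symm
    rw [e.deriv_eq]
    exact this

theorem congr (hT : SumsNormally T A) (h : ∀ n, ∀ z ∈ ball (0 : ℂ) 1, S n z = T n z)
    (hAB : ∀ z ∈ ball (0 : ℂ) 1, B z = A z) : SumsNormally S B := by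
  refine ⟨fun n => (hT.1 n).congr (h n), fun r hr => ?_, fun z hz => ?_⟩
  · obtain ⟨u, hu, hu'⟩ := hT.2.1 r hr
    exact ⟨u, hu, fun n z hz => by
      rw [h n z (ball_subset_ball hr.le hz)]
      exact hu' n z hz⟩
  · rw [hAB z hz]
    simpa only [h _ z hz] using hT.2.2 z hz

/-- For `r > 0`, absolute convergence at the real point `r` supplies the majorant on the disk of
radius `r`. -/
theorem of_hasSum_pow {a : ℕ → ℂ}
    (h : ∀ z ∈ ball (0 : ℂ) 1, HasSum (fun n => z ^ n * a n) (A z)) :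
    SumsNormally (fun n z => z ^ n * a n) A := by
  refine ⟨fun n => by fun_prop, fun r hr => ?_, h⟩
  rcases le_or_gt r 0 with h0 | h0
  · exact ⟨0, summable_zero, fun n z hz => by simp [ball_eq_empty.2 h0] at hz⟩
  · refine ⟨_, (h (r : ℂ) (by simpa [abs_of_pos h0] using hr)).summable.norm, fun n z hz => ?_⟩
    rw [norm_mul, norm_mul, norm_pow, norm_pow]
    have : ‖z‖ ≤ ‖(r : ℂ)‖ := by
      simpa [abs_of_pos h0] using (mem_ball_zero_iff.1 hz).le
    gcongr

end SumsNormally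

/-! ### The square root `R` and its branch -/

section Root

variable {ρ : ℂ} {x : ℝ}

/-- The imaginary part `2 Im ρ (Re ρ - x)` vanishes only if `ρ` is real or `x = Re ρ`. The value is
then at least `(1 - |ρ|)²`, respectively equal to `1 - |ρ|²`, hence positive. -/
theorem one_add_sq_sub_mem_slitPlane (hρ : ‖ρ‖ < 1) (hx : x ∈ Set.Icc (-1 : ℝ) 1) :
    1 + ρ ^ 2 - 2 * ρ * x ∈ Complex.slitPlane := by
  have h1 : ρ.re ^ 2 + ρ.im ^ 2 < 1 := by
    have := Complex.sq_norm ρ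
    rw [Complex.normSq_apply] at this
    nlinarith [norm_nonneg ρ]
  have hre : (1 + ρ ^ 2 - 2 * ρ * x).re = 1 + ρ.re ^ 2 - ρ.im ^ 2 - 2 * ρ.re * x := by
    simp [sq]; ring
  have him : (1 + ρ ^ 2 - 2 * ρ * x).im = 2 * ρ.im * (ρ.re - x) := by
    simp [sq]; ring
  rw [Complex.mem_slitPlane_iff, hre, him]
  by_cases h2 : ρ.im = 0
  · left
    rw [h2] at h1 ⊢
    nlinarith [sq_nonneg (ρ.re - x), hx.1, hx.2, sq_nonneg (ρ.re - 1), sq_nonneg (ρ.re + 1)]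
  by_cases h3 : ρ.re - x = 0
  · left
    rw [← sub_eq_zero.1 h3]
    nlinarith
  · right
    positivity

theorem cpow_half_re_pos {w : ℂ} (hw : w ∈ Complex.slitPlane) : 0 < (w ^ (1 / 2 : ℂ)).re := by
  rw [Complex.cpow_def_of_ne_zero (Complex.slitPlane_ne_zero hw), Complex.exp_re]
  refine mul_pos (Real.exp_pos _) (Real.cos_pos_of_mem_Ioo ?_)
  have : (Complex.log w * (1 / 2)).im = w.arg / 2 := by
    rw [show (1 / 2 : ℂ) = ((1 / 2 : ℝ) : ℂ) by norm_num, Complex.im_mul_ofReal, Complex.log_im]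
    ring
  rw [this]
  have h1 := Complex.neg_pi_lt_arg w
  have h2 := (Complex.arg_le_pi w).lt_of_ne (Complex.mem_slitPlane_iff_arg.1 hw).1
  constructor <;> linarith

theorem bigR_mem_slitPlane (hρ : ‖ρ‖ < 1) (hx : x ∈ Set.Icc (-1 : ℝ) 1) :
    bigR ρ x ∈ Complex.slitPlane :=
  Complex.mem_slitPlane_iff.2 (Or.inl (cpow_half_re_pos (one_add_sq_sub_mem_slitPlane hρ hx)))

theorem bigR_sq (ρ : ℂ) (x : ℝ) : bigR ρ x ^ 2 = 1 + ρ ^ 2 - 2 * ρ * x := by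
  rw [bigR, one_div, Complex.cpow_ofNat_inv_pow]

theorem hasDerivAt_bigR (hρ : ‖ρ‖ < 1) (hx : x ∈ Set.Icc (-1 : ℝ) 1) :
    HasDerivAt (fun z => bigR z x) ((ρ - x) / bigR ρ x) ρ := by
  have hW := one_add_sq_sub_mem_slitPlane hρ hx
  have hR := Complex.slitPlane_ne_zero (bigR_mem_slitPlane hρ hx)
  have h1 : HasDerivAt (fun z : ℂ => 1 + z ^ 2 - 2 * z * x) (2 * ρ - 2 * x) ρ := by
    exact ((((hasDerivAt_id ρ).pow 2).const_add 1).sub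
      (((hasDerivAt_id ρ).const_mul 2).mul_const (x : ℂ))).congr_deriv (by simp)
  have h2 := h1.cpow_const (c := 1 / 2) hW
  have e : (1 + ρ ^ 2 - 2 * ρ * x) ^ (1 / 2 - 1 : ℂ) = 1 / bigR ρ x := by
    rw [Complex.cpow_sub _ _ (Complex.slitPlane_ne_zero hW), Complex.cpow_one, ← bigR_sq,
      bigR_sq, ← bigR, ← bigR_sq]
    field_simp
  rw [e] at h2
  refine h2.congr_deriv ?_
  ring

theorem hasDerivAt_inv_bigR_cpow (hρ : ‖ρ‖ < 1) (hx : x ∈ Set.Icc (-1 : ℝ) 1) (s : ℂ) :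
    HasDerivAt (fun z => 1 / bigR z x ^ s)
      (-(s * (ρ - x) / bigR ρ x ^ 2) * (1 / bigR ρ x ^ s)) ρ := by
  have hR := bigR_mem_slitPlane hρ hx
  have hR0 := Complex.slitPlane_ne_zero hR
  have hE : bigR ρ x ^ s ≠ 0 := by simp [Complex.cpow_eq_zero_iff, hR0]
  have h := ((hasDerivAt_bigR hρ hx).cpow_const (c := s) hR).inv hE
  rw [Complex.cpow_sub _ _ hR0, Complex.cpow_one] at h
  simp only [one_div]
  refine h.congr_deriv ?_
  field_simp

end Root

/-! ### The kernel and the Gegenbauer generating function -/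

/-- The left-hand side of the expansion with `ζ₊`. -/
noncomputable def gegenbauerKernel (m : ℕ) (μ x : ℝ) (ρ : ℂ) : ℂ :=
  1 / bigR ρ x ^ (2 * (μ : ℂ) + m) * gegenbauerC m μ (zetaPlus ρ x)

section Kernel

variable {μ x : ℝ}

/-- Two identities drive this: `2ρ ζ₊' = (1 - ρ)(ζ₊² - 1) / R` and `1 - 2ρ(ρ - x) / R² = (1 - ρ) ζ₊
/ R`. They turn the right side into `(1 - ρ) R^(-2μ-m-1)` times the right side of `gegenbauerC_succ`
at `ζ₊`. -/
theorem gegenbauerKernel_succ (hμ : -1 / 2 < μ) (hx : x ∈ Set.Icc (-1 : ℝ) 1) (m : ℕ)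
    {ρ : ℂ} (hρ : ‖ρ‖ < 1) :
    ∃ A' : ℂ, HasDerivAt (gegenbauerKernel m μ x) A' ρ ∧
      (m + 1) * (1 - ρ) * gegenbauerKernel (m + 1) μ x ρ =
        (2 * μ + m) * gegenbauerKernel m μ x ρ + 2 * ρ * A' := by
  have hR0 := Complex.slitPlane_ne_zero (bigR_mem_slitPlane hρ hx)
  obtain ⟨C', hC', hC⟩ := gegenbauerC_succ hμ m (zetaPlus ρ x)
  have hζ : HasDerivAt (fun z => zetaPlus z x)
      ((1 * bigR ρ x - (1 + ρ) * ((ρ - x) / bigR ρ x)) / bigR ρ x ^ 2) ρ :=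
    ((hasDerivAt_id ρ).const_add 1).div (hasDerivAt_bigR hρ hx) hR0
  have hCζ := HasDerivAt.comp (h₂ := gegenbauerC m μ) ρ hC' hζ
  refine ⟨_, (hasDerivAt_inv_bigR_cpow hρ hx (2 * μ + m)).mul hCζ, ?_⟩
  have hs : (1 : ℂ) / bigR ρ x ^ (2 * (μ : ℂ) + (m + 1 : ℕ)) =
      1 / bigR ρ x ^ (2 * (μ : ℂ) + m) * (bigR ρ x)⁻¹ := by
    rw [show 2 * (μ : ℂ) + (m + 1 : ℕ) = 2 * μ + m + 1 by push_cast; ring,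
      Complex.cpow_add _ _ hR0, Complex.cpow_one]
    field_simp
  have hW : (1 + ρ ^ 2 - 2 * ρ * x) * (bigR ρ x)⁻¹ ^ 2 = 1 := by
    rw [← bigR_sq]; field_simp
  simp only [gegenbauerKernel, hs]
  rw [show zetaPlus ρ x = (1 + ρ) * (bigR ρ x)⁻¹ from rfl] at *
  simp only [div_eq_mul_inv, ← inv_pow]
  have hr : bigR ρ x * (bigR ρ x)⁻¹ = 1 := mul_inv_cancel₀ hR0
  generalize gegenbauerC m μ ((1 + ρ) * (bigR ρ x)⁻¹) = G at *
  generalize gegenbauerC (m + 1) μ ((1 + ρ) * (bigR ρ x)⁻¹) = G1 at *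
  generalize (bigR ρ x ^ (2 * (μ : ℂ) + m))⁻¹ = e at *
  generalize (bigR ρ x)⁻¹ = r at *
  linear_combination (1 - ρ) * e * r * hC + ((2 * μ + m) * e * G + e * C' * (1 + ρ) * r) * hW
    - 2 * ρ * e * C' * r * hr

theorem gegenbauerKernel_zero (μ x : ℝ) (ρ : ℂ) :
    gegenbauerKernel 0 μ x ρ = 1 / bigR ρ x ^ (2 * (μ : ℂ)) := by
  simp [gegenbauerKernel, gegenbauerC_zero]

theorem hasDerivAt_iteratedDeriv {f : ℂ → ℂ} {U : Set ℂ} (hU : IsOpen U)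
    (hf : DifferentiableOn ℂ f U) (n : ℕ) {z : ℂ} (hz : z ∈ U) :
    HasDerivAt (iteratedDeriv n f) (iteratedDeriv (n + 1) f z) z := by
  rw [iteratedDeriv_succ, hasDerivAt_deriv_iff]
  have : DifferentiableOn ℂ (iteratedDeriv n f) U := by
    induction n with
    | zero => simpa using hf
    | succ n ih => rw [iteratedDeriv_succ]; exact ih.deriv hU
  exact this.differentiableAt (hU.mem_nhds hz)

/-- The differential equation differentiated `n + 1` times; only three terms survive since its
coefficients have degree at most two. At `z = 0` it becomes the three-term recurrence for `n!
C_n^μ(x)`, which identifies the Taylor coefficients. -/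
theorem iteratedDeriv_kernel_recurrence {f : ℂ → ℂ} (hf : DifferentiableOn ℂ f (ball 0 1)) {μ x : ℂ}
    (h : ∀ z ∈ ball (0 : ℂ) 1, (1 + z ^ 2 - 2 * z * x) * deriv f z = 2 * μ * (x - z) * f z)
    (n : ℕ) : ∀ z ∈ ball (0 : ℂ) 1, (1 + z ^ 2 - 2 * z * x) * iteratedDeriv (n + 2) f z =
      2 * (x - z) * (n + 1 + μ) * iteratedDeriv (n + 1) f z -
        (n + 1) * (n + 2 * μ) * iteratedDeriv n f z := by
  have hW : ∀ z : ℂ, HasDerivAt (fun z : ℂ => 1 + z ^ 2 - 2 * z * x) (2 * z - 2 * x) z := fun z => by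
    exact ((((hasDerivAt_id z).pow 2).const_add 1).sub
      (((hasDerivAt_id z).const_mul 2).mul_const x)).congr_deriv (by simp)
  have hL : ∀ z : ℂ, HasDerivAt (fun z : ℂ => x - z) (-1) z := fun z =>
    (hasDerivAt_id z).const_sub x
  have hD := fun n {z : ℂ} => hasDerivAt_iteratedDeriv isOpen_ball hf n (z := z)
  induction n with
  | zero =>
    intro z hz
    have e : (fun z => (1 + z ^ 2 - 2 * z * x) * iteratedDeriv 1 f z) =ᶠ[nhds z]
        fun z => 2 * μ * ((x - z) * iteratedDeriv 0 f z) := by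
      filter_upwards [isOpen_ball.mem_nhds hz] with w hw
      rw [iteratedDeriv_one, iteratedDeriv_zero, h w hw]
      ring
    have := ((hW z).mul (hD 1 hz)).unique
      ((((hL z).mul (hD 0 hz)).const_mul (2 * μ)).congr_of_eventuallyEq e)
    simp only [zero_add, Nat.reduceAdd] at this ⊢
    push_cast
    linear_combination this
  | succ n ih =>
    intro z hz
    have e : (fun z => (1 + z ^ 2 - 2 * z * x) * iteratedDeriv (n + 2) f z) =ᶠ[nhds z]
        fun z => 2 * (n + 1 + μ) * ((x - z) * iteratedDeriv (n + 1) f z) -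
        (n + 1) * (n + 2 * μ) * iteratedDeriv n f z := by
      filter_upwards [isOpen_ball.mem_nhds hz] with w hw
      rw [ih w hw]
      ring
    have := ((hW z).mul (hD (n + 2) hz)).unique
      (((((hL z).mul (hD (n + 1) hz)).const_mul (2 * (n + 1 + μ))).sub
        ((hD n hz).const_mul ((n + 1) * (n + 2 * μ)))).congr_of_eventuallyEq e)
    simp only [add_assoc, Nat.reduceAdd] at this ⊢
    push_cast
    linear_combination this

theorem gegenbauer_generating_function (hμ : -1 / 2 < μ) (hx : x ∈ Set.Icc (-1 : ℝ) 1) {ρ : ℂ}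
    (hρ : ρ ∈ ball (0 : ℂ) 1) :
    HasSum (fun n => ρ ^ n * gegenbauerC n μ x) (gegenbauerKernel 0 μ x ρ) := by
  have hf : ∀ z ∈ ball (0 : ℂ) 1, HasDerivAt (gegenbauerKernel 0 μ x)
      (-(2 * μ * (z - x) / bigR z x ^ 2) * gegenbauerKernel 0 μ x z) z := fun z hz => by
    have e : gegenbauerKernel 0 μ x = fun z => 1 / bigR z x ^ (2 * (μ : ℂ)) :=
      funext fun z => gegenbauerKernel_zero μ x z
    rw [e]
    exact hasDerivAt_inv_bigR_cpow (mem_ball_zero_iff.1 hz) hx (2 * μ)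
  have hd : DifferentiableOn ℂ (gegenbauerKernel 0 μ x) (ball 0 1) := fun z hz =>
    (hf z hz).differentiableAt.differentiableWithinAt
  have h0 : (0 : ℂ) ∈ ball (0 : ℂ) 1 := by simp
  have hA0 : gegenbauerKernel 0 μ x 0 = 1 := by simp [gegenbauerKernel_zero, bigR]
  have ode : ∀ z ∈ ball (0 : ℂ) 1, (1 + z ^ 2 - 2 * z * x) * deriv (gegenbauerKernel 0 μ x) z =
      2 * μ * (x - z) * gegenbauerKernel 0 μ x z := fun z hz => by
    have hR0 := Complex.slitPlane_ne_zero (bigR_mem_slitPlane (mem_ball_zero_iff.1 hz) hx)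
    rw [(hf z hz).deriv, ← bigR_sq]
    field_simp
    ring
  have hc : ∀ n, iteratedDeriv n (gegenbauerKernel 0 μ x) 0 = n.factorial * gegenbauerC n μ x := by
    intro n
    induction n using Nat.twoStepInduction with
    | zero => simp [hA0, gegenbauerC_zero]
    | one =>
      have := ode 0 h0
      rw [hA0] at this
      simp only [iteratedDeriv_one, gegenbauerC_one hμ, Nat.factorial_one, Nat.cast_one]
      linear_combination this
    | more n h1 h2 =>
      have h3 := iteratedDeriv_kernel_recurrence hd ode n 0 h0
      have h4 := gegenbauerC_three_term hμ n x
      rw [h1, h2] at h3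
      simp only [Nat.factorial_succ] at h3 ⊢
      push_cast at h3 ⊢
      linear_combination h3 - (n + 1) * n.factorial * h4
  refine (Complex.hasSum_taylorSeries_on_ball hd hρ).congr_fun fun n => ?_
  have hn : (n.factorial : ℂ) ≠ 0 := by exact_mod_cast n.factorial_ne_zero
  rw [hc, sub_zero, smul_eq_mul, smul_eq_mul]
  field_simp

end Kernel

/-! ### The coefficient functions and the reduced expansion -/

/-- The coefficient functions of the expansion in Gegenbauer polynomials. -/
noncomputable def kernelCoeff (n : ℕ) (c : ℂ) (m : ℕ) (z : ℂ) : ℂ :=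
  z ^ n * (poch c m / m.factorial * (1 - z)⁻¹ ^ m * gaussF m (1 - m) (c + 1) (-z / (1 - z)))

theorem kernelCoeff_zero (n : ℕ) (c z : ℂ) : kernelCoeff n c 0 z = z ^ n := by
  have : gaussF (0 : ℕ) (1 - (0 : ℕ)) (c + 1) (-z / (1 - z)) = 1 := by
    rw [gaussF_eq_hypPoly (j := 0) (N := 0) _ le_rfl (Or.inl (by simp)), hypPoly]
    simp [hypCoeff, poch_zero]
  rw [kernelCoeff, this]
  simp [poch_zero]

/-- With `w = -z / (1 - z)` one has `z dw/dz = w(1 - w)`, and the logarithmic derivative of `z ^ n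
(1 - z)^(-m)` times `z` is `n - m w`; the relation reduces to `gaussF_legendre_succ`. For `c = 2μ +
2n` the factor `c - 2n + m` is `2μ + m`, free of `n`. -/
theorem kernelCoeff_succ (n : ℕ) {c : ℂ} (hc : 0 < (c + 1).re) (m : ℕ) {z : ℂ} (hz : z ≠ 1) :
    ∃ T' : ℂ, HasDerivAt (kernelCoeff n c m) T' z ∧
      (m + 1) * (1 - z) * kernelCoeff n c (m + 1) z =
        (c - 2 * n + m) * kernelCoeff n c m z + 2 * z * T' := by
  have hz' : 1 - z ≠ 0 := sub_ne_zero.2 hz.symm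
  obtain ⟨F', hF', hF⟩ := gaussF_legendre_succ hc m (-z / (1 - z))
  have h1 : HasDerivAt (fun z : ℂ => 1 - z) (-1) z := (hasDerivAt_id z).const_sub 1
  have hw : HasDerivAt (fun z : ℂ => -z / (1 - z)) ((-1 * (1 - z) - -z * -1) / (1 - z) ^ 2) z :=
    (hasDerivAt_id z).neg.div h1 hz'
  have hT := (hasDerivAt_pow n z).mul ((((h1.inv hz').pow m).const_mul
    (poch c m / m.factorial)).mul (hF'.comp z hw))
  refine ⟨_, hT.congr_of_eventuallyEq (Filter.Eventually.of_forall fun w => rfl), ?_⟩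
  have hn : z * (n * z ^ (n - 1)) = n * z ^ n := by
    rcases n with _ | n
    · simp
    · rw [Nat.add_sub_cancel, pow_succ]; ring
  have hm : (m : ℂ) * (1 - z)⁻¹ ^ (m - 1) * (1 - z)⁻¹ = m * (1 - z)⁻¹ ^ m := by
    rcases m with _ | m
    · simp
    · rw [Nat.add_sub_cancel, pow_succ]; ring
  have hf : (m.factorial : ℂ) ≠ 0 := by exact_mod_cast m.factorial_ne_zero
  have hm1 : (m : ℂ) + 1 ≠ 0 := by exact_mod_cast m.succ_ne_zero
  have hq : (m + 1) * (poch c (m + 1) / (m + 1).factorial) =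
      (c + m) * (poch c m / m.factorial) := by
    rw [poch_succ, Nat.factorial_succ]; push_cast; field_simp
  simp only [kernelCoeff, Function.comp, Pi.mul_apply, Pi.inv_apply, Pi.pow_apply]
  push_cast
  rw [show (1 : ℂ) - (m + 1) = -m by ring]
  simp only [div_eq_mul_inv, ← inv_pow, neg_mul, neg_neg, one_mul] at *
  have hi : (1 - z) * (1 - z)⁻¹ = 1 := mul_inv_cancel₀ hz'
  rw [pow_succ]
  generalize gaussF (m + 1) (-m) (c + 1) (-(z * (1 - z)⁻¹)) = G1 at *
  generalize gaussF m (1 - m) (c + 1) (-(z * (1 - z)⁻¹)) = G at *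
  generalize poch c (m + 1) * ((m + 1).factorial : ℂ)⁻¹ = q1 at *
  generalize poch c m * (m.factorial : ℂ)⁻¹ = q at *
  generalize (1 - z)⁻¹ ^ m = p at *
  generalize (1 - z)⁻¹ = i at *
  linear_combination z ^ n * (1 - z) * i * p * G1 * hq + z ^ n * (1 - z) * i * p * q * hF +
    (z ^ n * p * q * ((c + m + 2 * m * z * i) * G - 2 * z * i * (1 + z * i) * F') +
      2 * z * i * z ^ n * p * q * F') * hi - 2 * q * p * G * hn - 2 * z * z ^ n * q * i * G * hm

theorem sumsNormally_gegenbauerKernel {μ x : ℝ} (hμ : -1 / 2 < μ) (hx : x ∈ Set.Icc (-1 : ℝ) 1)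
    (m : ℕ) : SumsNormally (fun n z => gegenbauerC n μ x * kernelCoeff n (2 * μ + 2 * n) m z)
      (gegenbauerKernel m μ x) := by
  have hne : ∀ z ∈ ball (0 : ℂ) 1, z ≠ 1 := by
    rintro z hz rfl
    simp at hz
  induction m with
  | zero =>
    refine (SumsNormally.of_hasSum_pow fun z hz => gegenbauer_generating_function hμ hx hz).congr
      (fun n z _ => ?_) fun z _ => rfl
    rw [kernelCoeff_zero, mul_comm]
  | succ m ih =>
    have hm : (m : ℂ) + 1 ≠ 0 := by exact_mod_cast m.succ_ne_zero
    have hden : ∀ z ∈ ball (0 : ℂ) 1, ((m : ℂ) + 1) * (1 - z) ≠ 0 := fun z hz =>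
      mul_ne_zero hm (sub_ne_zero.2 (hne z hz).symm)
    have h1 : DifferentiableOn ℂ (fun z : ℂ => (2 * (μ : ℂ) + m) / (((m : ℂ) + 1) * (1 - z))) (ball 0 1) :=
      DifferentiableOn.fun_div (by fun_prop) (by fun_prop) hden
    have h2 : DifferentiableOn ℂ (fun z : ℂ => 2 * z / (((m : ℂ) + 1) * (1 - z))) (ball 0 1) :=
      DifferentiableOn.fun_div (by fun_prop) (by fun_prop) hden
    refine ((ih.mul_left h1).add (ih.deriv.mul_left h2)).congr (fun n z hz => ?_) fun z hz => ?_
    · have hc : 0 < (2 * (μ : ℂ) + 2 * n + 1).re := by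
        have : (2 * (μ : ℂ) + 2 * n + 1).re = 2 * μ + 2 * n + 1 := by simp
        rw [this]
        have : (0 : ℝ) ≤ n := n.cast_nonneg
        linarith
      obtain ⟨T', hT', hT⟩ := kernelCoeff_succ n hc m (hne z hz)
      rw [(hT'.const_mul (gegenbauerC n μ x)).deriv, div_mul_eq_mul_div, div_mul_eq_mul_div,
        ← add_div, eq_div_iff (hden z hz)]
      linear_combination gegenbauerC n μ x * hT
    · obtain ⟨A', hA', hA⟩ := gegenbauerKernel_succ hμ hx m (mem_ball_zero_iff.1 hz)
      rw [hA'.deriv, div_mul_eq_mul_div, div_mul_eq_mul_div, ← add_div, eq_div_iff (hden z hz)]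
      linear_combination hA

/-! ### Matching the Legendre and Ferrers terms -/

theorem Gamma_add_natCast_eq_poch_mul {a : ℂ} (ha : ∀ k : ℕ, a + k ≠ 0) (n : ℕ) :
    Complex.Gamma (a + n) = poch a n * Complex.Gamma a := by
  induction n with
  | zero => simp [poch_zero]
  | succ n ih =>
    rw [Nat.cast_succ, ← add_assoc, Complex.Gamma_add_one _ (ha n), ih, poch_succ]
    ring

theorem two_mul_add_natCast_ne_zero {μ : ℝ} (hμ : -1 / 2 < μ) (hμ0 : μ ≠ 0) (N : ℕ) :
    2 * (μ : ℂ) + N ≠ 0 := by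
  have : 2 * μ + N ≠ 0 := by
    rcases N with _ | N
    · simpa using hμ0
    · have : (0 : ℝ) ≤ N := N.cast_nonneg
      push_cast
      linarith
  exact_mod_cast this

theorem Gamma_two_mul_add_natCast_ne_zero {μ : ℝ} (hμ : -1 / 2 < μ) (hμ0 : μ ≠ 0) (N : ℕ) :
    Complex.Gamma (2 * (μ : ℂ) + N) ≠ 0 := by
  refine Complex.Gamma_ne_zero fun k h => two_mul_add_natCast_ne_zero hμ hμ0 (N + k) ?_
  push_cast
  linear_combination h

/-- Both `Γ(2μ+m) (2μ+m)_{2n}` and `Γ(2μ+2n) (2μ+2n)_m` equal `Γ(2μ+m+2n)`, while `Γ(2μ+2n+1) =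
2(n+μ) Γ(2μ+2n)`. The conditions on `μ` keep all arguments off the poles. -/
theorem Gamma_mul_poch_div_Gamma {μ : ℝ} (hμ : -1 / 2 < μ) (hμ0 : μ ≠ 0) (m n : ℕ) :
    2 * Complex.Gamma (2 * μ + m) * ((n + μ) * poch (2 * μ + m) (2 * n)) /
      Complex.Gamma (2 * μ + 2 * n + 1) = poch (2 * μ + 2 * n) m := by
  have ne := two_mul_add_natCast_ne_zero hμ hμ0
  have h1 := Gamma_add_natCast_eq_poch_mul (a := 2 * μ + m) (fun k => by
    simpa [add_assoc] using ne (m + k)) (2 * n)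
  have h2 := Gamma_add_natCast_eq_poch_mul (a := 2 * μ + 2 * n) (fun k => by
    simpa [add_assoc] using ne (2 * n + k)) m
  have h0 : (2 * (μ : ℂ) + 2 * n) ≠ 0 := by simpa using ne (2 * n)
  have h3 := Complex.Gamma_add_one _ h0
  have h4 : Complex.Gamma (2 * μ + 2 * n) ≠ 0 := by
    simpa using Gamma_two_mul_add_natCast_ne_zero hμ hμ0 (2 * n)
  push_cast at h1
  rw [add_right_comm, h2] at h1
  rw [h3, div_eq_iff (mul_ne_zero h0 h4)]
  linear_combination -2 * (n + μ) * h1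

theorem one_div_cpow_neg {ρ : ℂ} (hρ : ρ ∈ Complex.slitPlane) (μ : ℂ) (n : ℕ) :
    (1 / ρ) ^ ((-2 * μ - 2 * n) / 2) = ρ ^ μ * ρ ^ n := by
  rw [one_div, Complex.inv_cpow _ _ (Complex.mem_slitPlane_iff_arg.1 hρ).1, ← Complex.cpow_neg,
    show -((-2 * μ - 2 * n) / 2) = μ + n by ring,
    Complex.cpow_add _ _ (Complex.slitPlane_ne_zero hρ), Complex.cpow_natCast]

theorem legendreP_eq {ρ : ℂ} (hρ : ρ ∈ Complex.slitPlane) (h1 : ρ ≠ 1) (m n : ℕ) (μ : ℂ) :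
    legendreP (-(m : ℂ)) (-2 * μ - 2 * n) ((1 + ρ) / (1 - ρ)) =
      1 / Complex.Gamma (2 * μ + 2 * n + 1) * (ρ ^ μ * ρ ^ n) *
        gaussF m (1 - m) (2 * μ + 2 * n + 1) (-ρ / (1 - ρ)) := by
  have h0 := Complex.slitPlane_ne_zero hρ
  have h1' : 1 - ρ ≠ 0 := sub_ne_zero.2 h1.symm
  have e1 : ((1 + ρ) / (1 - ρ) + 1) / ((1 + ρ) / (1 - ρ) - 1) = 1 / ρ := by
    rw [div_add_one h1', div_sub_one h1', div_div_div_cancel_right₀ h1',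
      show 1 + ρ + (1 - ρ) = 2 by ring, show 1 + ρ - (1 - ρ) = 2 * ρ by ring]
    field_simp
  have e2 : (1 - (1 + ρ) / (1 - ρ)) / 2 = -ρ / (1 - ρ) := by
    field_simp
    ring
  rw [legendreP, e1, e2, one_div_cpow_neg hρ, neg_neg,
    show 1 - (-2 * μ - 2 * n) = 2 * μ + 2 * n + 1 by ring, neg_add_eq_sub]

theorem ferrersP_eq {ρ : ℝ} (hρ : 0 < ρ) (m n : ℕ) (μ : ℂ) :
    ferrersP (-(m : ℂ)) (-2 * μ - 2 * n) ((1 - ρ) / (1 + ρ)) =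
      1 / Complex.Gamma (2 * μ + 2 * n + 1) * ((ρ : ℂ) ^ μ * (ρ : ℂ) ^ n) *
        gaussF m (1 - m) (2 * μ + 2 * n + 1) (ρ / (1 + ρ)) := by
  have h0 : (ρ : ℂ) ≠ 0 := by exact_mod_cast hρ.ne'
  have h1' : 1 + (ρ : ℂ) ≠ 0 := by
    have : 1 + ρ ≠ 0 := by positivity
    exact_mod_cast this
  have e1 : (1 + (1 - (ρ : ℂ)) / (1 + ρ)) / (1 - (1 - (ρ : ℂ)) / (1 + ρ)) = 1 / ρ := by
    rw [one_add_div h1', one_sub_div h1', div_div_div_cancel_right₀ h1',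
      show 1 + (ρ : ℂ) + (1 - ρ) = 2 by ring, show 1 + (ρ : ℂ) - (1 - ρ) = 2 * ρ by ring]
    field_simp
  have e2 : (1 - (1 - (ρ : ℂ)) / (1 + ρ)) / 2 = ρ / (1 + ρ) := by
    field_simp
    ring
  rw [ferrersP]
  push_cast
  rw [e1, e2, one_div_cpow_neg (Complex.ofReal_mem_slitPlane.2 hρ), neg_neg,
    show 1 - (-2 * μ - 2 * n) = 2 * μ + 2 * n + 1 by ring, neg_add_eq_sub]

theorem mem_slitPlane_of_mem_slitDisk {ρ : ℂ} (hρ : ρ ∈ slitDisk) : ρ ∈ Complex.slitPlane := by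
  by_contra h
  rw [Complex.mem_slitPlane_iff, not_or, not_lt, not_not] at h
  have e : ρ = (ρ.re : ℂ) := Complex.ext rfl (by simp [h.2])
  refine hρ.2 ⟨ρ.re, ⟨?_, h.1⟩, e⟩
  have h1 : ‖ρ‖ < 1 := hρ.1
  exact (abs_lt.1 ((Complex.abs_re_le_norm ρ).trans_lt h1)).1

theorem const_mul_plusTerm {μ : ℝ} (hμ : -1 / 2 < μ) (hμ0 : μ ≠ 0) (m : ℕ) (x : ℝ) {ρ : ℂ}
    (hρ : ρ ∈ slitDisk) (n : ℕ) :
    2 * Complex.Gamma (2 * μ + m) / ((m.factorial : ℂ) * ρ ^ (μ : ℂ) * (1 - ρ) ^ m) *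
      plusTerm m μ x ρ n = gegenbauerC n μ x * kernelCoeff n (2 * μ + 2 * n) m ρ := by
  have hs := mem_slitPlane_of_mem_slitDisk hρ
  have h1 : ρ ≠ 1 := by
    rintro rfl
    have h : ‖(1 : ℂ)‖ < 1 := hρ.1
    simp at h
  have hp : ρ ^ (μ : ℂ) ≠ 0 := by simp [Complex.cpow_eq_zero_iff, Complex.slitPlane_ne_zero hs]
  rw [plusTerm, legendreP_eq hs h1, kernelCoeff, ← Gamma_mul_poch_div_Gamma hμ hμ0]
  simp only [div_eq_mul_inv, mul_inv, inv_pow]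
  linear_combination (mul_inv_cancel₀ hp) * (2 * Complex.Gamma (2 * μ + m) *
    (m.factorial : ℂ)⁻¹ * ((1 - ρ) ^ m)⁻¹ * (n + μ) * poch (2 * μ + m) (2 * n) *
    (Complex.Gamma (2 * μ + 2 * n + 1))⁻¹ * ρ ^ n *
    gaussF m (1 - m) (2 * μ + 2 * n + 1) (-ρ * (1 - ρ)⁻¹) * gegenbauerC n μ x)

/-- The Ferrers term carries `ρ ^ n`, while `kernelCoeff` at `-ρ` carries `(-ρ) ^ n`; the sign `(-1)
^ n` is offset by the parity of `C_n^μ` at `-x`. -/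
theorem const_mul_minusTerm {μ : ℝ} (hμ : -1 / 2 < μ) (hμ0 : μ ≠ 0) (m : ℕ) (x : ℝ) {ρ : ℝ}
    (hρ : 0 < ρ) (n : ℕ) :
    2 * Complex.Gamma (2 * μ + m) / ((m.factorial : ℂ) * (ρ : ℂ) ^ (μ : ℂ) * (1 + (ρ : ℂ)) ^ m) *
      minusTerm m μ x ρ n =
        gegenbauerC n μ (-x : ℝ) * kernelCoeff n (2 * μ + 2 * n) m (-ρ) := by
  have hp : (ρ : ℂ) ^ (μ : ℂ) ≠ 0 := by
    simp [Complex.cpow_eq_zero_iff, hρ.ne']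
  have hn : ((-1 : ℂ) ^ n) * (-1) ^ n = 1 := by rw [← mul_pow]; simp
  rw [minusTerm, ferrersP_eq hρ, kernelCoeff, ← Gamma_mul_poch_div_Gamma hμ hμ0, neg_neg,
    sub_neg_eq_add, Complex.ofReal_neg, gegenbauerC_neg hμ, neg_pow (ρ : ℂ)]
  simp only [div_eq_mul_inv, mul_inv, inv_pow]
  linear_combination ((mul_inv_cancel₀ hp) - hn) * (2 * Complex.Gamma (2 * μ + m) *
    (m.factorial : ℂ)⁻¹ * ((1 + (ρ : ℂ)) ^ m)⁻¹ * (n + μ) * poch (2 * μ + m) (2 * n) *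
    (Complex.Gamma (2 * μ + 2 * n + 1))⁻¹ * (ρ : ℂ) ^ n *
    gaussF m (1 - m) (2 * μ + 2 * n + 1) (ρ * (1 + (ρ : ℂ))⁻¹) * gegenbauerC n μ x)

/-- A nonzero constant lets summability pass back from `K * f` to `f`; in `ℂ` this is absolute
convergence. -/
theorem summable_and_eq_mul_tsum {f g : ℕ → ℂ} {K A : ℂ} (hK : K ≠ 0) (h : ∀ n, K * f n = g n)
    (hg : HasSum g A) : Summable f ∧ A = K * ∑' n, f n := by
  rw [← funext h] at hg
  exact ⟨(summable_mul_left_iff hK).1 hg.summable, by rw [← hg.tsum_eq, tsum_mul_left]⟩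

theorem gegenbauerKernel_neg_neg (m : ℕ) (μ x ρ : ℝ) :
    gegenbauerKernel m μ (-x) (-ρ) =
      1 / bigR ρ x ^ (2 * (μ : ℂ) + m) * gegenbauerC m μ (zetaMinus ρ x) := by
  have e : bigR (-ρ) (-x) = bigR ρ x := by
    rw [bigR, bigR]
    push_cast
    congr 1
    ring
  rw [gegenbauerKernel, zetaPlus, zetaMinus, e, sub_eq_add_neg]

theorem mainTheorem4 (m : ℕ) (μ : ℝ) (hμ : -1 / 2 < μ) (hμ0 : μ ≠ 0)
    (x : ℝ) (hx : x ∈ Set.Icc (-1 : ℝ) 1) :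
    (∀ ρ : ℂ, ρ ∈ slitDisk →
      Summable (plusTerm m μ x ρ) ∧
      1 / bigR ρ x ^ (2 * (μ : ℂ) + m) * gegenbauerC m μ (zetaPlus ρ x) =
        2 * Complex.Gamma (2 * μ + m) / ((m.factorial : ℂ) * ρ ^ (μ : ℂ) * (1 - ρ) ^ m) *
          ∑' n : ℕ, plusTerm m μ x ρ n) ∧
    (∀ ρ : ℝ, ρ ∈ Set.Ioo (0 : ℝ) 1 →
      Summable (minusTerm m μ x ρ) ∧
      1 / bigR ρ x ^ (2 * (μ : ℂ) + m) * gegenbauerC m μ (zetaMinus ρ x) =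
        2 * Complex.Gamma (2 * μ + m) / ((m.factorial : ℂ) * (ρ : ℂ) ^ (μ : ℂ) * (1 + (ρ : ℂ)) ^ m) *
          ∑' n : ℕ, minusTerm m μ x ρ n) := by
  have hΓ := Gamma_two_mul_add_natCast_ne_zero hμ hμ0 m
  have hm : (m.factorial : ℂ) ≠ 0 := by exact_mod_cast m.factorial_ne_zero
  refine ⟨fun ρ hρ => ?_, fun ρ hρ => ?_⟩
  · have h1 : 1 - ρ ≠ 0 := fun h => by
      have hn : ‖ρ‖ < 1 := hρ.1
      rw [← sub_eq_zero.1 h] at hn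
      simp at hn
    have hp : ρ ^ (μ : ℂ) ≠ 0 := by
      simp [Complex.cpow_eq_zero_iff,
        Complex.slitPlane_ne_zero (mem_slitPlane_of_mem_slitDisk hρ)]
    exact summable_and_eq_mul_tsum
      (div_ne_zero (mul_ne_zero two_ne_zero hΓ) (mul_ne_zero (mul_ne_zero hm hp) (pow_ne_zero m h1)))
      (const_mul_plusTerm hμ hμ0 m x hρ)
      ((sumsNormally_gegenbauerKernel hμ hx m).2.2 ρ (mem_ball_zero_iff.2 hρ.1))
  · have h1 : 1 + (ρ : ℂ) ≠ 0 := by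
      have : 1 + ρ ≠ 0 := by linarith [hρ.1]
      exact_mod_cast this
    have hp : (ρ : ℂ) ^ (μ : ℂ) ≠ 0 := by
      simp [Complex.cpow_eq_zero_iff, hρ.1.ne']
    have hx' : -x ∈ Set.Icc (-1 : ℝ) 1 := ⟨by linarith [hx.2], by linarith [hx.1]⟩
    -- The point `-ρ` lies on the cut excluded from (i), but the reduced expansion is valid there.
    rw [← gegenbauerKernel_neg_neg]
    refine summable_and_eq_mul_tsum
      (div_ne_zero (mul_ne_zero two_ne_zero hΓ) (mul_ne_zero (mul_ne_zero hm hp) (pow_ne_zero m h1)))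
      (const_mul_minusTerm hμ hμ0 m x hρ.1)
      ((sumsNormally_gegenbauerKernel hμ hx' m).2.2 (-ρ) ?_)
    simpa [abs_of_pos hρ.1] using hρ.2
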